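/- **Conventions.** Structures are nonempty. An abstract elementary class (AEC) $K=(K,\prec_K)$ in a language $L$ is a class $K$ of $L$-structures with a partial order $\prec_K$ on $K$ such that: $M\prec_K N$ implies that $M$ is a substructure of $N$; $K$ and $\prec_K$ are closed under isomorphism; (coherence) if $M_0\prec_K M_2$, $M_1\prec_K M_2$ and $M_0\subseteq M_1$, then $M_0\prec_K M_1$; (Tarski–Vaught) if $\langle M_i : i<\alpha\rangle$ ($\alpha>0$) is a $\prec_K$-increasing continuous chain in $K$, then $\bigcup_{i<\alpha} M_i\in K$ and $M_j\prec_K\bigcup_{i<\alpha} M_i$ for all $j<\alpha$, and if moreover $N\in K$ and $M_i\prec_K N$ for all $i<\alpha$, then $\bigcup_{i<\alpha} M_i\prec_K N$; and there is a least cardinal $\lambda\ge|L|+\aleph_0$, denoted $LS(K)$, such that for all $M\in K$ and $A\subseteq M$ there is $N\prec_K M$ with $A\subseteq N$ and $\|N\|\le|A|+\lambda$. A map $f:M\to N$ is a $K$-embedding if it is an isomorphism of $M$ onto a substructure $f(M)$ of $N$ with $f(M)\prec_K N$. $K$ is *essentially below* a cardinal $\kappa$ if $LS(K)<\kappa$,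 or $K=(\mathrm{Mod}\,T,\prec_{\mathcal F})$ for some $L_{\kappa,\omega}$-theory $T$ and some fragment $\mathcal F$ of $L_{\kappa,\omega}$; here $M\prec_{\mathcal F}N$ means that $M\subseteq N$ and every formula of $\mathcal F$ has the same truth value in $M$ and $N$ at all tuples from $M$. An ultrafilter is $\kappa$-complete if it is closed under intersections of fewer than $\kappa$ of its members. $\prod_{i}M_i/U$ is the ultraproduct, with elements $[f]_U$ for $f\in\prod_i M_i$. **Theorem (Łoś' Theorem for AECs).** Let $\kappa$ be a cardinal, $U$ a $\kappa$-complete ultrafilter on a set $I$, and $K$ an AEC that is essentially below $\kappa$. Then $K$ and the class of $K$-embeddings are closed under ultraproducts by $U$ in the following sense. 1. If $M_i\in K$ for all $i\in I$, then $\prod_i M_i/U\in K$. 2. If $M_i\prec_K N_i$ for all $i\in I$, then $\prod_i M_i/U\prec_K\prod_i N_i/U$ (that is, the canonical map $[f]_U\mapsto[f]_U$ is a $K$-embedding). 3. If $M_i,N_i\in K$ and $h_i:M_i\cong N_i$ for all $i\in I$, then $\prod_i h_i:[f]_U\mapsto[i\mapsto h_i(f(i))]_U$ is a well-defined isomorphism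 $\prod_i M_i/U\cong\prod_i N_i/U$. 4. If $h_i:M_i\to N_i$ is a $K$-embedding for all $i\in I$, then $\prod_i h_i$ (defined as in 3) is a $K$-embedding $\prod_i M_i/U\to\prod_i N_i/U$. 5. If $I=\kappa$, $U$ is non-principal, and $\langle M_i\in K:i<\kappa\rangle$ is a $\prec_K$-increasing (not necessarily continuous) sequence with union $M$, then $M\in K$ and the map $h:M\to\prod_i M_i/U$, $h(m)=[f_m]_U$, where $f_m(i)=m$ if $m\in M_i$ and $f_m(i)\in M_i$ is arbitrary otherwise, is a $K$-embedding. 6. If $\{M_i\in K:i\in I\}$ is directed under $\prec_K$ with union $M$, and $\{i\in I:m\in M_i\}\in U$ for every $m\in M$, then $M\in K$ and the map $h:M\to\prod_i M_i/U$ defined as in 5 is a $K$-embedding. In particular, for every $M\in K$ the diagonal map $m\mapsto[i\mapsto m]_U$ of $M$ into its ultrapower $\prod_{i\in I} M/U$ is a $K$-embedding. -/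

import Mathlib

open FirstOrder Cardinal

universe u

namespace LosAEC

/-! ### The infinitary logic `L_{κ,ω}` -/

/-- Formulas of `L_{κ,ω}` with free variables among `x₀, …, xₙ₋₁`: finitary atomic formulas, closed
under implication, quantification over one element (of the last variable) and conjunctions of fewer
than `κ` formulas.  The other connectives are the usual abbreviations, e.g. `¬φ` is `φ → ⊥` and
`⋁ᵢ φᵢ` is `¬ ⋀ᵢ ¬φᵢ`. -/
inductive InfFormula (L : FirstOrder.Language.{u, u}) (κ : Cardinal.{u}) : ℕ → Type (u + 1)
  | falsum {n : ℕ} : InfFormula L κ n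
  | equal {n : ℕ} (s t : L.Term (Fin n)) : InfFormula L κ n
  | rel {n l : ℕ} (R : L.Relations l) (ts : Fin l → L.Term (Fin n)) : InfFormula L κ n
  | imp {n : ℕ} (φ ψ : InfFormula L κ n) : InfFormula L κ n
  | all {n : ℕ} (φ : InfFormula L κ (n + 1)) : InfFormula L κ n
  | conj {n : ℕ} {ι : Type u} (hι : #ι < κ) (φ : ι → InfFormula L κ n) : InfFormula L κ n

namespace InfFormula

variable {L : FirstOrder.Language.{u, u}} {κ : Cardinal.{u}}

/-- Satisfaction of a formula of `L_{κ,ω}` in an `L`-structure under an assignment. -/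
def Realize {M : Type u} [L.Structure M] : {n : ℕ} → InfFormula L κ n → (Fin n → M) → Prop
  | _, falsum, _ => False
  | _, equal s t, v => s.realize v = t.realize v
  | _, rel R ts, v => Language.Structure.RelMap R fun k => (ts k).realize v
  | _, imp φ ψ, v => φ.Realize v → ψ.Realize v
  | _, all φ, v => ∀ a : M, φ.Realize (Fin.snoc v a)
  | _, conj _ φ, v => ∀ i, (φ i).Realize v

/-- Simultaneous (capture-free) substitution of terms for the free variables. -/
def subst : {n : ℕ} → InfFormula L κ n → {m : ℕ} → (Fin n → L.Term (Fin m)) → InfFormula L κ m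
  | _, falsum, _, _ => falsum
  | _, equal s t, _, σ => equal (s.subst σ) (t.subst σ)
  | _, rel R ts, _, σ => rel R fun k => (ts k).subst σ
  | _, imp φ ψ, _, σ => imp (φ.subst σ) (ψ.subst σ)
  | _, all φ, m, σ =>
      all (φ.subst (Fin.snoc (α := fun _ => L.Term (Fin (m + 1)))
        (fun k => (σ k).relabel Fin.castSucc) (Language.Term.var (Fin.last m))))
  | _, conj hι φ, _, σ => conj hι fun i => (φ i).subst σ

end InfFormula

/-- A fragment of `L_{κ,ω}`: a collection of formulas that contains the atomic formulas and is closed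
under the finitary connectives, quantifiers, subformulas and substitution of terms. -/
structure Fragment (L : FirstOrder.Language.{u, u}) (κ : Cardinal.{u}) where
  formulas : (n : ℕ) → Set (InfFormula L κ n)
  falsum_mem : ∀ n, InfFormula.falsum ∈ formulas n
  equal_mem : ∀ {n : ℕ} (s t : L.Term (Fin n)), InfFormula.equal s t ∈ formulas n
  rel_mem : ∀ {n l : ℕ} (R : L.Relations l) (ts : Fin l → L.Term (Fin n)),
    InfFormula.rel R ts ∈ formulas n
  imp_mem_iff : ∀ {n : ℕ} (φ ψ : InfFormula L κ n),
    InfFormula.imp φ ψ ∈ formulas n ↔ φ ∈ formulas n ∧ ψ ∈ formulas n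
  all_mem_iff : ∀ {n : ℕ} (φ : InfFormula L κ (n + 1)),
    InfFormula.all φ ∈ formulas n ↔ φ ∈ formulas (n + 1)
  of_conj_mem : ∀ {n : ℕ} {ι : Type u} (hι : #ι < κ) (φ : ι → InfFormula L κ n),
    InfFormula.conj hι φ ∈ formulas n → ∀ i, φ i ∈ formulas n
  subst_mem : ∀ {n m : ℕ} (φ : InfFormula L κ n) (σ : Fin n → L.Term (Fin m)),
    φ ∈ formulas n → φ.subst σ ∈ formulas m

/-- For an `L`-substructure `S` of `N`: `S ≺_F N`, i.e. the formulas of the fragment `F` are absolute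
between `S` and `N` for parameters from `S`. -/
def Fragment.Elementary {L : FirstOrder.Language.{u, u}} {κ : Cardinal.{u}} (F : Fragment L κ)
    {N : Type u} [L.Structure N] (S : L.Substructure N) : Prop :=
  ∀ (n : ℕ), ∀ φ ∈ F.formulas n, ∀ a : Fin n → S,
    φ.Realize a ↔ φ.Realize fun k => (a k : N)

/-! ### Abstract elementary classes -/

/-- For substructures `S`, `T` of one structure, and a relation `P` "is a strong substructure of":
`S ≤ T`, and `S`, seen as a substructure of the structure `T`, satisfies `P`. -/
def PrecOf {L : FirstOrder.Language.{u, u}}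
    (P : {N : Type u} → [L.Structure N] → L.Substructure N → Prop)
    {M : Type u} [L.Structure M] (S T : L.Substructure M) : Prop :=
  S ≤ T ∧ P (S.comap T.subtype.toHom)

/-- `S` is an increasing (with respect to the strong substructure relation given by `P`) continuous
chain of substructures of one structure, indexed by a well-order. -/
def IsContChainOf {L : FirstOrder.Language.{u, u}}
    (P : {N : Type u} → [L.Structure N] → L.Substructure N → Prop)
    {M : Type u} [L.Structure M] {ι : Type u} [LinearOrder ι] (S : ι → L.Substructure M) : Prop :=
  (∀ i j, i < j → PrecOf P (S i) (S j)) ∧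
    ∀ j, Order.IsSuccLimit j → (S j : Set M) = ⋃ i, ⋃ (_ : i < j), (S i : Set M)

/-- An abstract elementary class in the language `L`.  `Mem M` says that the `L`-structure `M`
belongs to `K`; `Strong S`, for a substructure `S` of `N`, says that `S ≺_K N`.  (As `M ≺_K N`
entails that `M` is a substructure of `N`, the relation `≺_K` is a relation between structures and
their substructures.  An increasing chain of structures is a chain of substructures of its union.)
Structures are nonempty, as usual in model theory. -/
structure AEC (L : FirstOrder.Language.{u, u}) where
  Mem : (M : Type u) → [L.Structure M] → Prop
  Strong : {N : Type u} → [L.Structure N] → L.Substructure N → Prop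
  nonempty_of_mem : ∀ (M : Type u) [L.Structure M], Mem M → Nonempty M
  -- `≺_K` is a relation on `K`
  mem_of_strong : ∀ {N : Type u} [L.Structure N] (S : L.Substructure N), Strong S → Mem N
  mem_sub_of_strong : ∀ {N : Type u} [L.Structure N] (S : L.Substructure N), Strong S → Mem S
  -- `≺_K` is a partial order (antisymmetry is automatic)
  strong_refl : ∀ (N : Type u) [L.Structure N], Mem N → Strong (⊤ : L.Substructure N)
  strong_trans : ∀ {N : Type u} [L.Structure N] (S T : L.Substructure N),
    PrecOf Strong S T → Strong T → Strong S
  -- `K` and `≺_K` respect isomorphisms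
  mem_iso : ∀ {N N' : Type u} [L.Structure N] [L.Structure N'] (_ : N ≃[L] N'), Mem N → Mem N'
  strong_iso : ∀ {N N' : Type u} [L.Structure N] [L.Structure N'] (e : N ≃[L] N')
    (S : L.Substructure N), Strong S → Strong (S.map e.toHom)
  -- coherence
  coherence : ∀ {N : Type u} [L.Structure N] (S T : L.Substructure N),
    Strong S → Strong T → S ≤ T → PrecOf Strong S T
  -- Tarski-Vaught axioms
  chain_union : ∀ {M : Type u} [L.Structure M] {ι : Type u} [LinearOrder ι] [WellFoundedLT ι]
    [Nonempty ι] (S : ι → L.Substructure M), (∀ i, Mem (S i)) → IsContChainOf Strong S →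
    (⋃ i, (S i : Set M)) = Set.univ → Mem M ∧ ∀ i, Strong (S i)
  chain_bound : ∀ {N : Type u} [L.Structure N] {ι : Type u} [LinearOrder ι] [WellFoundedLT ι]
    [Nonempty ι] (S : ι → L.Substructure N), (∀ i, Mem (S i)) → IsContChainOf Strong S →
    (∀ i, Strong (S i)) → ∀ T : L.Substructure N, (T : Set N) = ⋃ i, (S i : Set N) → Strong T
  -- the Löwenheim-Skolem number exists
  exists_LS : ∃ c : Cardinal.{u}, L.card + ℵ₀ ≤ c ∧
    ∀ (M : Type u) [L.Structure M], Mem M → ∀ A : Set M,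
      ∃ S : L.Substructure M, Strong S ∧ A ⊆ S ∧ #S ≤ #A + c

namespace AEC

variable {L : FirstOrder.Language.{u, u}}

/-- The Löwenheim-Skolem number `LS(K)`. -/
noncomputable def LS (K : AEC L) : Cardinal.{u} :=
  sInf {c : Cardinal.{u} | L.card + ℵ₀ ≤ c ∧
    ∀ (M : Type u) [L.Structure M], K.Mem M → ∀ A : Set M,
      ∃ S : L.Substructure M, K.Strong S ∧ A ⊆ S ∧ #S ≤ #A + c}

/-- `S ≺_K T` for two substructures `S`, `T` of one `L`-structure (which need not be in `K`). -/
def Prec (K : AEC L) {M : Type u} [L.Structure M] (S T : L.Substructure M) : Prop :=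
  PrecOf K.Strong S T

/-- `f : M → N` is a `K`-embedding: it is an isomorphism of `M` onto a substructure `f(M)` of `N`
with `f(M) ≺_K N`. -/
def IsEmbedding (K : AEC L) {M N : Type u} [L.Structure M] [L.Structure N] (f : M → N) : Prop :=
  ∃ g : M ↪[L] N, ⇑g = f ∧ K.Strong g.toHom.range

/-- `K = (Mod T, ≺_F)`, for a theory `T` and a fragment `F` of `L_{κ,ω}`. -/
def IsModClass (K : AEC L) {κ : Cardinal.{u}} (T : Set (InfFormula L κ 0)) (F : Fragment L κ) :
    Prop :=
  (∀ (M : Type u) [L.Structure M],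
    K.Mem M ↔ Nonempty M ∧ ∀ φ ∈ T, φ.Realize (Fin.elim0 : Fin 0 → M)) ∧
  ∀ {N : Type u} [L.Structure N] (S : L.Substructure N),
    K.Strong S ↔ K.Mem S ∧ K.Mem N ∧ F.Elementary S

/-- `K` is essentially below `κ`. -/
def EssentiallyBelow (K : AEC L) (κ : Cardinal.{u}) : Prop :=
  K.LS < κ ∨ ∃ (T : Set (InfFormula L κ 0)) (F : Fragment L κ), K.IsModClass T F

end AEC

/-! ### Maps into and between ultraproducts -/

/-- The coordinatewise map `∏ hᵢ : ∏ Mᵢ / U → ∏ Nᵢ / U`, `[f] ↦ [i ↦ hᵢ (f i)]`. -/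
def ultraMap {I : Type u} (U : Ultrafilter I) {M N : I → Type u} (h : ∀ i, M i → N i) :
    (U : Filter I).Product M → (U : Filter I).Product N :=
  Quotient.map' (fun f i => h i (f i)) fun _ _ hfg => hfg.mono fun i hi => congrArg (h i) hi

/-- `f` picks, for each `m`, a function `f_m` in `∏ Sᵢ` with `f_m(i) = m` whenever `m ∈ Sᵢ`
(and with arbitrary values elsewhere). -/
def IsDiagonalChoice {L : FirstOrder.Language.{u, u}} {I M : Type u} [L.Structure M]
    (S : I → L.Substructure M) (f : M → ∀ i, S i) : Prop :=
  ∀ m i, m ∈ S i → (f m i : M) = m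

/-- For a family `S` of substructures of `M` (with union `M`): `M ∈ K`, and the canonical map
`M → ∏ Sᵢ / U`, `m ↦ [f_m]`, where `f_m(i) = m` if `m ∈ Sᵢ` and `f_m(i)` is arbitrary
otherwise, is a `K`-embedding (for all choices of the arbitrary values; they exist). -/
def CanonicalMapIsEmbedding {L : FirstOrder.Language.{u, u}} (K : AEC L) {I : Type u} (U : Ultrafilter I)
    {M : Type u} [L.Structure M] (S : I → L.Substructure M) : Prop :=
  K.Mem M ∧ (∃ f : M → ∀ i, S i, IsDiagonalChoice S f) ∧
    ∀ f : M → ∀ i, S i, IsDiagonalChoice S f →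
      K.IsEmbedding (fun m => ((f m : ∀ i, S i) : (U : Filter I).Product fun i => S i))

end LosAEC

namespace LosAEC

namespace AEC

variable {L : FirstOrder.Language.{u, u}} (K : AEC L)

/-! ### Strong substructures inside an ambient structure -/

/-! If `K` is the class of models of an `L_{κ,ω}`-theory, κ-completeness gives Łoś's theorem for all
formulas of `L_{κ,ω}` (`realize_ultraMk`), and membership, strong substructures and diagonal maps
are read off from it.

If `LS(K) < κ`, there are no formulas, and small structures take their place. An ultraproduct of
structures of size at most `LS(K)` is described by fewer than κ conditions, so by κ-completeness it
is isomorphic to one of its factors, even with a distinguished substructure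
(`exists_equiv_ultraproduct_of_card_le`). Hence `≺_K` passes to ultraproducts of small structures.
An arbitrary ultraproduct is the union of the ultraproducts of small strong substructures of its
factors; this family is directed because upper bounds can be chosen coordinatewise. Since AECs are
closed under directed unions (`prec_of_directed`, from the chain axioms), the general case follows.
For the diagonal map, the ultrapower of a small structure consists of diagonal elements only, so the
diagonal image of `M` is the directed union of ultrapowers of small strong substructures.

For a directed union `M` of the `S i`, the canonical map followed by the inclusion of the
ultraproduct into the ultrapower of `M` is the diagonal map, so coherence makes it a `K`-embedding.
Chains of length κ are a special case, as a non-principal κ-complete ultrafilter contains all final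
segments. -/

theorem strong_congr {N N' : Type u} [L.Structure N] [L.Structure N'] (e : N ≃[L] N')
    {S : L.Substructure N} {S' : L.Substructure N'} (h : ∀ x, x ∈ S ↔ e x ∈ S')
    (hS : K.Strong S) : K.Strong S' := by
  have := K.strong_iso e S hS
  convert this
  ext y
  rw [Language.Substructure.mem_map]
  constructor
  · intro hy
    exact ⟨e.symm y, (h _).2 (by simpa using hy), by simp⟩
  · rintro ⟨x, hx, rfl⟩
    exact (h x).1 hx

theorem strong_congr_iff {N N' : Type u} [L.Structure N] [L.Structure N'] (e : N ≃[L] N')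
    {S : L.Substructure N} {S' : L.Substructure N'} (h : ∀ x, x ∈ S ↔ e x ∈ S') :
    K.Strong S ↔ K.Strong S' :=
  ⟨K.strong_congr e h, K.strong_congr e.symm fun x => by rw [h]; simp⟩

theorem mem_iso_iff {N N' : Type u} [L.Structure N] [L.Structure N'] (e : N ≃[L] N') :
    K.Mem N ↔ K.Mem N' :=
  ⟨K.mem_iso e, K.mem_iso e.symm⟩

/-- `g` identifies `N` with the structure `T`. This is how the axioms are used inside an ambient `P`
that is not yet known to lie in `K`, such as an ultraproduct. -/
theorem prec_iff_strong {N P : Type u} [L.Structure N] [L.Structure P] (g : N ↪[L] P)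
    {S : L.Substructure N} {S' T : L.Substructure P} (hT : g.toHom.range = T) (hle : S' ≤ T)
    (h : ∀ x, x ∈ S ↔ g x ∈ S') : K.Prec S' T ↔ K.Strong S := by
  subst hT
  have : K.Strong S ↔ K.Strong (S'.comap g.toHom.range.subtype.toHom) :=
    K.strong_congr_iff g.equivRange h
  rw [this]
  exact ⟨fun h => h.2, fun h => ⟨hle, h⟩⟩

theorem prec_map_iff {N P : Type u} [L.Structure N] [L.Structure P] (g : N ↪[L] P)
    {S T : L.Substructure N} : K.Prec (S.map g.toHom) (T.map g.toHom) ↔ K.Prec S T := by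
  have hg : ∀ (R : L.Substructure N) x, g x ∈ R.map g.toHom ↔ x ∈ R := fun R x => by
    rw [Language.Substructure.mem_map]
    exact ⟨fun ⟨y, hy, hyx⟩ => g.injective hyx ▸ hy, fun hx => ⟨x, hx, rfl⟩⟩
  by_cases hle : S ≤ T
  · rw [K.prec_iff_strong (S := S.comap T.subtype.toHom) (g.comp T.subtype) ?_
      (Language.Substructure.monotone_map hle) ?_]
    · exact ⟨fun h => ⟨hle, h⟩, fun h => h.2⟩
    · ext y
      rw [Language.Hom.mem_range, Language.Substructure.mem_map]
      exact ⟨fun ⟨x, hx⟩ => ⟨x, x.2, hx⟩, fun ⟨x, hx, hxy⟩ => ⟨⟨x, hx⟩, hxy⟩⟩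
    · intro x
      exact (hg S x).symm
  · refine ⟨fun h => absurd (fun x hx => ?_) hle, fun h => absurd h.1 hle⟩
    exact (hg T x).1 (h.1 ((hg S x).2 hx))

theorem prec_range_iff {N P : Type u} [L.Structure N] [L.Structure P] (g : N ↪[L] P)
    {S : L.Substructure N} : K.Prec (S.map g.toHom) g.toHom.range ↔ K.Strong S :=
  K.prec_iff_strong g rfl Language.Hom.map_le_range fun x => by
    rw [Language.Substructure.mem_map]
    exact ⟨fun hx => ⟨x, hx, rfl⟩, fun ⟨y, hy, hyx⟩ => g.injective hyx ▸ hy⟩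

section

variable {M : Type u} [L.Structure M] {S T X : L.Substructure M}

theorem map_comap_subtype (h : S ≤ X) : (S.comap X.subtype.toHom).map X.subtype.toHom = S := by
  ext y
  rw [Language.Substructure.mem_map]
  exact ⟨fun ⟨x, hx, hxy⟩ => hxy ▸ hx, fun hy => ⟨⟨y, h hy⟩, hy, rfl⟩⟩

theorem prec_comap_iff (hS : S ≤ X) (hT : T ≤ X) :
    K.Prec (S.comap X.subtype.toHom) (T.comap X.subtype.toHom) ↔ K.Prec S T := by
  rw [← K.prec_map_iff X.subtype, map_comap_subtype hS, map_comap_subtype hT]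

theorem prec_top_iff : K.Prec S ⊤ ↔ K.Strong S :=
  K.prec_iff_strong (Language.Embedding.refl L M)
    (by ext y; simp) le_top fun x => by simp

variable {K}

theorem Prec.mem_right (h : K.Prec S T) : K.Mem T := K.mem_of_strong _ h.2

theorem mem_comap_subtype_iff (h : S ≤ T) :
    K.Mem (S.comap T.subtype.toHom) ↔ K.Mem S := by
  have := T.subtype.substructureEquivMap (S.comap T.subtype.toHom)
  rw [map_comap_subtype h] at this
  exact K.mem_iso_iff this

theorem Prec.mem_left (h : K.Prec S T) : K.Mem S :=
  (mem_comap_subtype_iff h.1).1 (K.mem_sub_of_strong _ h.2)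

theorem Prec.refl (h : K.Mem S) : K.Prec S S := by
  refine ⟨le_rfl, ?_⟩
  convert K.strong_refl S h
  ext x
  simp

theorem Prec.trans (h₁ : K.Prec S T) (h₂ : K.Prec T X) : K.Prec S X := by
  refine ⟨h₁.1.trans h₂.1, K.strong_trans _ (T.comap X.subtype.toHom) ?_ h₂.2⟩
  exact (K.prec_comap_iff (h₁.1.trans h₂.1) h₂.1).2 h₁

theorem Prec.strong (h₁ : K.Prec S T) (h₂ : K.Strong T) : K.Strong S := K.strong_trans _ _ h₁ h₂

theorem Prec.of_le (h₁ : K.Prec S X) (h₂ : K.Prec T X) (h : S ≤ T) : K.Prec S T :=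
  (K.prec_comap_iff h₁.1 h₂.1).1 (K.coherence _ _ h₁.2 h₂.2 fun _ hx => h hx)

end

/-! ### `K`-embeddings -/

variable {K} {M N P : Type u} [L.Structure M] [L.Structure N] [L.Structure P]

/-- Coherence, applied in `P` to the images of `g ∘ f` and of `g`, and pulled back along `g`. -/
theorem IsEmbedding.of_comp {g : N → P} {f : M → N} (hg : K.IsEmbedding g)
    (hgf : K.IsEmbedding (g ∘ f)) : K.IsEmbedding f := by
  obtain ⟨g, rfl, hg⟩ := hg
  obtain ⟨d, hd, hS⟩ := hgf
  have hd' : ∀ x, d x = g (f x) := fun x => congrFun hd x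
  let f' : M ↪[L] N :=
    { toFun := f
      inj' := fun x y hxy => d.injective (by rw [hd', hd', hxy])
      map_fun' := fun φ x => g.injective (by
        rw [← hd', d.map_fun, g.map_fun]
        exact congrArg _ (funext fun i => hd' _))
      map_rel' := fun R x => by
        rw [← g.map_rel, ← d.map_rel]
        exact iff_of_eq (congrArg _ (funext fun i => (hd' _).symm)) }
  refine ⟨f', rfl, ?_⟩
  rw [← K.prec_range_iff g]
  have : f'.toHom.range.map g.toHom = d.toHom.range := by
    rw [← Language.Hom.range_comp]
    ext y
    simp only [Language.Hom.mem_range]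
    exact exists_congr fun x => by
      rw [show d.toHom x = g (f x) from hd' x]
      rfl
  rw [this]
  refine (K.coherence _ _ hS hg ?_)
  rw [← this]
  exact Language.Hom.map_le_range

/-! ### Unions of chains and of directed families -/

section

variable {ι : Type u}

theorem prec_of_chain [LinearOrder ι] [WellFoundedLT ι] [Nonempty ι] {S : ι → L.Substructure M}
    (hmem : ∀ i, K.Mem (S i)) (hS : IsContChainOf K.Strong S) {X : L.Substructure M}
    (hX : (X : Set M) = ⋃ i, (S i : Set M)) : ∀ i, K.Prec (S i) X := by
  have hle : ∀ i, S i ≤ X := fun i x hx => by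
    rw [← SetLike.mem_coe, hX]
    exact Set.mem_iUnion_of_mem i hx
  have := K.chain_union (M := X) (fun i => (S i).comap X.subtype.toHom)
    (fun i => (mem_comap_subtype_iff (hle i)).2 (hmem i))
    ⟨fun i j hij => (K.prec_comap_iff (hle i) (hle j)).2 (hS.1 i j hij), fun j hj => ?_⟩ ?_
  · exact fun i => ⟨hle i, this.2 i⟩
  · ext x
    have := Set.ext_iff.1 (hS.2 j hj) x
    simpa using this
  · ext x
    have := Set.ext_iff.1 hX x
    simpa using this

theorem prec_bound_of_chain [LinearOrder ι] [WellFoundedLT ι] [Nonempty ι]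
    {S : ι → L.Substructure M} (hS : IsContChainOf K.Strong S) {X Y : L.Substructure M}
    (hX : (X : Set M) = ⋃ i, (S i : Set M)) (hY : ∀ i, K.Prec (S i) Y) : K.Prec X Y := by
  have hle : X ≤ Y := fun x hx => by
    rw [← SetLike.mem_coe, hX] at hx
    obtain ⟨i, hi⟩ := Set.mem_iUnion.1 hx
    exact (hY i).1 hi
  refine ⟨hle, K.chain_bound (N := Y) (fun i => (S i).comap Y.subtype.toHom)
    (fun i => (mem_comap_subtype_iff (hY i).1).2 (hY i).mem_left)
    ⟨fun i j hij => (K.prec_comap_iff (hY i).1 (hY j).1).2 (hS.1 i j hij), fun j hj => ?_⟩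
    (fun i => (hY i).2) _ ?_⟩
  · ext x
    have := Set.ext_iff.1 (hS.2 j hj) x
    simpa using this
  · ext x
    have := Set.ext_iff.1 hX x
    simpa using this

/-- The union of the members of a family, indexed by the finite subsets of `ι`, whose index is
contained in `A`. -/
def finsetUnion (h : Finset ι → L.Substructure M) (A : Set ι) : L.Substructure M :=
  ⨆ F : {F : Finset ι // (F : Set ι) ⊆ A}, h F

theorem mem_finsetUnion {h : Finset ι → L.Substructure M} (hh : Monotone h) {A : Set ι} {x : M} :
    x ∈ finsetUnion h A ↔ ∃ F : Finset ι, (F : Set ι) ⊆ A ∧ x ∈ h F := by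
  classical
  have : Nonempty {F : Finset ι // (F : Set ι) ⊆ A} := ⟨∅, by simp⟩
  have hd : Directed (· ≤ ·) fun F : {F : Finset ι // (F : Set ι) ⊆ A} => h F := fun F G =>
    ⟨⟨F.1 ∪ G.1, by simp [F.2, G.2]⟩, hh Finset.subset_union_left, hh Finset.subset_union_right⟩
  rw [finsetUnion, Language.Substructure.mem_iSup_of_directed hd]
  simp

/-- Induction on `#A`. A finite `A` is itself the largest index. An infinite `A` is the union of a
chain of initial segments `B j` of smaller cardinality; the bound property for `B i` makes the chain
increasing, and finiteness of the indices makes it continuous, so the Tarski–Vaught axioms apply. -/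
theorem prec_finsetUnion {h : Finset ι → L.Substructure M}
    (hh : ∀ F G, F ⊆ G → K.Prec (h F) (h G)) (A : Set ι) :
    (∀ F : Finset ι, (F : Set ι) ⊆ A → K.Prec (h F) (finsetUnion h A)) ∧
      ∀ Y : L.Substructure M, (∀ F : Finset ι, (F : Set ι) ⊆ A → K.Prec (h F) Y) →
        K.Prec (finsetUnion h A) Y := by
  have hm : Monotone h := fun F G hFG => (hh F G hFG).1
  induction hc : #A using WellFoundedLT.induction generalizing A with
  | ind c ih =>
  subst hc
  by_cases hA : A.Finite
  · obtain ⟨G, rfl⟩ := hA.exists_finset_coe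
    have : finsetUnion h (G : Set ι) = h G := by
      ext x
      rw [mem_finsetUnion hm]
      exact ⟨fun ⟨F, hF, hx⟩ => hm (Finset.coe_subset.1 hF) hx, fun hx => ⟨G, subset_rfl, hx⟩⟩
    rw [this]
    exact ⟨fun F hF => hh F G (Finset.coe_subset.1 hF), fun Y hY => hY G subset_rfl⟩
  have hinf : ℵ₀ ≤ #A := by
    rw [Cardinal.aleph0_le_mk_iff]
    exact Set.infinite_coe_iff.2 hA
  let J := (#A).ord.ToType
  have : NoMaxOrder J := Cardinal.noMaxOrder hinf
  obtain ⟨e⟩ : Nonempty (J ≃ A) := Cardinal.eq.1 (by simp [J])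
  have : Nonempty J := by
    have := Set.infinite_coe_iff.2 hA
    exact e.nonempty
  -- Initial segments of an enumeration of `A` in order type `(#A).ord`, hence of size less than
  -- `#A`.
  let B : J → Set ι := fun j => (fun i => (e i : ι)) '' Set.Iio j
  have hBA : ∀ j, B j ⊆ A := by
    rintro j _ ⟨i, _, rfl⟩
    exact (e i).2
  have hBmono : Monotone B := fun i j hij => Set.image_mono (Set.Iio_subset_Iio hij)
  have hBc : ∀ j, #(B j) < #A := fun j =>
    Cardinal.mk_image_le.trans_lt ((Cardinal.mk_Iio_lt j (by simp [J])).trans_eq (by simp [J]))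
  -- Continuity at limits: the last two premises say that `j` is not minimal and that nothing below
  -- `j` is largest, so a finite subset of `B j` already lies in an earlier `B i`.
  have hfin : ∀ j : J, ∀ F : Finset ι, (∀ x ∈ F, ∃ i, i < j ∧ (e i : ι) = x) → (∃ i, i < j) →
      (∀ i, i < j → ∃ k, i < k ∧ k < j) → ∃ i, i < j ∧ (F : Set ι) ⊆ B i := by
    classical
    intro j F
    induction F using Finset.induction_on with
    | empty => exact fun _ ⟨i, hi⟩ _ => ⟨i, hi, by simp⟩
    | insert a F _ IH =>
      intro hF hne hlim
      obtain ⟨i, hi, hFi⟩ := IH (fun x hx => hF x (Finset.mem_insert_of_mem hx)) hne hlim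
      obtain ⟨k, hk, rfl⟩ := hF a (Finset.mem_insert_self _ _)
      obtain ⟨l, hl, hlj⟩ := hlim (max i k) (max_lt hi hk)
      refine ⟨l, hlj, ?_⟩
      rw [Finset.coe_insert]
      exact Set.insert_subset ⟨k, (le_max_right _ _).trans_lt hl, rfl⟩
        (hFi.trans (hBmono ((le_max_left _ _).trans hl.le)))
  have hfinA : ∀ F : Finset ι, (F : Set ι) ⊆ A → ∃ j, (F : Set ι) ⊆ B j := by
    classical
    intro F
    induction F using Finset.induction_on with
    | empty => exact fun _ => ⟨Classical.arbitrary J, by simp⟩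
    | insert a F _ IH =>
      intro hF
      rw [Finset.coe_insert, Set.insert_subset_iff] at hF
      obtain ⟨i, hFi⟩ := IH hF.2
      obtain ⟨l, hl⟩ := exists_gt (max i (e.symm ⟨a, hF.1⟩))
      refine ⟨l, ?_⟩
      rw [Finset.coe_insert]
      exact Set.insert_subset ⟨e.symm ⟨a, hF.1⟩, (le_max_right _ _).trans_lt hl, by simp⟩
        (hFi.trans (hBmono ((le_max_left _ _).trans hl.le)))
  have hIH := fun j => ih _ (hBc j) (B j) rfl
  have hpre : ∀ i j, i ≤ j → K.Prec (finsetUnion h (B i)) (finsetUnion h (B j)) := fun i j hij =>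
    (hIH i).2 _ fun F hF => (hIH j).1 F (hF.trans (hBmono hij))
  have hchain : IsContChainOf K.Strong fun j => finsetUnion h (B j) := by
    refine ⟨fun i j hij => hpre i j hij.le, fun j hj => ?_⟩
    ext x
    simp only [Set.mem_iUnion, SetLike.mem_coe, exists_prop]
    refine ⟨fun hx => ?_, fun ⟨i, hi, hx⟩ => (hpre i j hi.le).1 hx⟩
    obtain ⟨F, hF, hxF⟩ := (mem_finsetUnion hm).1 hx
    obtain ⟨i, hi, hFi⟩ := hfin j F (fun x hx => hF hx) (not_isMin_iff.1 hj.1) fun i hi => by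
      by_contra! hcon
      exact hj.2 i ⟨hi, fun k hk hkj => (hcon k hk).not_gt hkj⟩
    exact ⟨i, hi, (mem_finsetUnion hm).2 ⟨F, hFi, hxF⟩⟩
  have hX : (finsetUnion h A : Set M) = ⋃ j, (finsetUnion h (B j) : Set M) := by
    ext x
    simp only [Set.mem_iUnion, SetLike.mem_coe, mem_finsetUnion hm]
    constructor
    · rintro ⟨F, hF, hx⟩
      obtain ⟨j, hj⟩ := hfinA F hF
      exact ⟨j, F, hj, hx⟩
    · rintro ⟨j, F, hF, hx⟩
      exact ⟨F, hF.trans (hBA j), hx⟩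
  have hmem : ∀ j, K.Mem (finsetUnion h (B j)) := fun j => ((hIH j).1 ∅ (by simp)).mem_right
  constructor
  · intro F hF
    obtain ⟨j, hj⟩ := hfinA F hF
    exact ((hIH j).1 F hj).trans (prec_of_chain hmem hchain hX j)
  · exact fun Y hY => prec_bound_of_chain hchain hX fun j =>
      (hIH j).2 Y fun F hF => hY F (hF.trans (hBA j))

/-- Recursion on finite sets: `g s` bounds both the elements of `s` and the values of `g` at all
proper subsets of `s`, which forces monotonicity. -/
theorem exists_finset_upper_bounds {α : Type u} [Preorder α] [IsDirectedOrder α] [Nonempty α] :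
    ∃ g : Finset α → α, Monotone g ∧ ∀ a, a ≤ g {a} := by
  classical
  have key : ∀ s : Finset α, ∃ m, ∀ i ∈ s, i ≤ m := Finset.exists_le
  choose ub hub using key
  let g : Finset α → α := fun F => Finset.strongInduction
    (fun s IH => ub (s ∪ s.ssubsets.attach.image fun t => IH t.1 (Finset.mem_ssubsets.1 t.2))) F
  have hg : ∀ s, g s = ub (s ∪ s.ssubsets.attach.image fun t => g t.1) := fun s =>
    Finset.strongInduction_eq _ s
  refine ⟨g, fun F G hFG => ?_, fun a => ?_⟩
  · rcases hFG.eq_or_ssubset with rfl | hlt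
    · exact le_rfl
    · rw [hg G]
      refine hub _ _ (Finset.mem_union_right _ (Finset.mem_image.2
        ⟨⟨F, Finset.mem_ssubsets.2 hlt⟩, Finset.mem_attach _ _, rfl⟩))
  · rw [hg]
    exact hub _ _ (by simp)

/-- Upper bounds of finite sets of indices, chosen monotonically in the preorder that `≺_K` induces
on `ι`, turn the directed family into a cofinal one indexed by finite sets. -/
theorem prec_of_directed [Nonempty ι] {S : ι → L.Substructure M} (hmem : ∀ i, K.Mem (S i))
    (hd : ∀ i j, ∃ k, K.Prec (S i) (S k) ∧ K.Prec (S j) (S k)) {X : L.Substructure M}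
    (hX : (X : Set M) = ⋃ i, (S i : Set M)) :
    (∀ i, K.Prec (S i) X) ∧ ∀ Y, (∀ i, K.Prec (S i) Y) → K.Prec X Y := by
  let _ : Preorder ι :=
    { le := fun i j => K.Prec (S i) (S j)
      le_refl := fun i => .refl (hmem i)
      le_trans := fun _ _ _ h₁ h₂ => h₁.trans h₂ }
  have : IsDirectedOrder ι := ⟨hd⟩
  obtain ⟨g, hg, hg'⟩ := exists_finset_upper_bounds (α := ι)
  have hh : ∀ F G, F ⊆ G → K.Prec (S (g F)) (S (g G)) := fun F G hFG => hg hFG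
  have h := prec_finsetUnion hh Set.univ
  have hXe : X = finsetUnion (fun F => S (g F)) Set.univ := by
    ext x
    rw [mem_finsetUnion fun F G hFG => (hh F G hFG).1, ← SetLike.mem_coe, hX, Set.mem_iUnion]
    exact ⟨fun ⟨i, hi⟩ => ⟨{i}, Set.subset_univ _, (show K.Prec _ _ from hg' i).1 hi⟩,
      fun ⟨F, _, hx⟩ => ⟨g F, hx⟩⟩
  rw [hXe]
  exact ⟨fun i => (show K.Prec _ _ from hg' i).trans (h.1 {i} (Set.subset_univ _)),
    fun Y hY => h.2 Y fun F _ => hY _⟩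

end

end AEC

/-! ### Ultraproducts of structures, embeddings and substructures -/

section Ultraproduct

open Filter

variable {L : FirstOrder.Language.{u, u}} {I : Type u} (U : Ultrafilter I)

/-- The class of `f` in the ultraproduct. -/
abbrev ultraMk {M : I → Type u} (f : ∀ i, M i) : (U : Filter I).Product M :=
  (f : (U : Filter I).Product M)

variable {U} {M N : I → Type u}

theorem ultraMk_eq_iff {f g : ∀ i, M i} :
    ultraMk U f = ultraMk U g ↔ ∀ᶠ i in (U : Filter I), f i = g i :=
  Quotient.eq''

theorem ultraMk_surjective : Function.Surjective (ultraMk U (M := M)) :=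
  Quotient.mk_surjective

theorem ultraMap_ultraMk (h : ∀ i, M i → N i) (f : ∀ i, M i) :
    ultraMap U h (ultraMk U f) = ultraMk U fun i => h i (f i) :=
  rfl

variable [∀ i, L.Structure (M i)] [∀ i, L.Structure (N i)]

theorem relMap_ultraMk {n : ℕ} (R : L.Relations n) (x : Fin n → ∀ i, M i) :
    (Language.Structure.RelMap R fun k => ultraMk U (x k)) ↔
      ∀ᶠ i in (U : Filter I), Language.Structure.RelMap R fun k => x k i := by
  let _ := Language.Ultraproduct.setoidPrestructure (L := L) M U
  exact Language.relMap_quotient_mk' (s := (U : Filter I).productSetoid M) R x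

theorem funMap_ultraMk {n : ℕ} (φ : L.Functions n) (x : Fin n → ∀ i, M i) :
    (Language.Structure.funMap φ fun k => ultraMk U (x k)) =
      ultraMk U fun i => Language.Structure.funMap φ fun k => x k i :=
  Language.Ultraproduct.funMap_cast φ x

theorem realize_term_ultraMk {n : ℕ} (t : L.Term (Fin n)) (v : Fin n → ∀ i, M i) :
    (t.realize fun k => ultraMk U (v k)) = ultraMk U fun i => t.realize fun k => v k i :=
  Language.Ultraproduct.term_realize_cast v t

/-- The coordinatewise embedding of ultraproducts. -/
def ultraEmb (U : Ultrafilter I) (g : ∀ i, M i ↪[L] N i) :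
    (U : Filter I).Product M ↪[L] (U : Filter I).Product N where
  toFun := ultraMap U fun i => ⇑(g i)
  inj' x y h := by
    obtain ⟨f, rfl⟩ := ultraMk_surjective x
    obtain ⟨f', rfl⟩ := ultraMk_surjective y
    rw [ultraMap_ultraMk, ultraMap_ultraMk, ultraMk_eq_iff] at h
    exact ultraMk_eq_iff.2 (h.mono fun i hi => (g i).injective hi)
  map_fun' {n} φ x := by
    choose f hf using fun k => ultraMk_surjective (x k)
    obtain rfl : x = fun k => ultraMk U (f k) := funext fun k => (hf k).symm
    rw [funMap_ultraMk]
    refine Eq.trans ?_ (funMap_ultraMk φ fun k i => g i (f k i)).symm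
    refine congrArg (ultraMk U) (funext fun i => ?_)
    exact (g i).map_fun φ _
  map_rel' {n} R x := by
    choose f hf using fun k => ultraMk_surjective (x k)
    obtain rfl : x = fun k => ultraMk U (f k) := funext fun k => (hf k).symm
    rw [relMap_ultraMk]
    refine (relMap_ultraMk R fun k i => g i (f k i)).trans (eventually_congr (.of_forall ?_))
    exact fun i => (g i).map_rel R _

theorem ultraEmb_ultraMk (g : ∀ i, M i ↪[L] N i) (f : ∀ i, M i) :
    ultraEmb U g (ultraMk U f) = ultraMk U fun i => g i (f i) := rfl

/-- The coordinatewise isomorphism of ultraproducts. -/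
def ultraEquiv (U : Ultrafilter I) (h : ∀ i, M i ≃[L] N i) :
    (U : Filter I).Product M ≃[L] (U : Filter I).Product N where
  toFun := ultraMap U fun i => ⇑(h i)
  invFun := ultraMap U fun i => ⇑(h i).symm
  left_inv x := by
    obtain ⟨f, rfl⟩ := ultraMk_surjective x
    exact congrArg (ultraMk U) (funext fun i => (h i).symm_apply_apply _)
  right_inv x := by
    obtain ⟨f, rfl⟩ := ultraMk_surjective x
    exact congrArg (ultraMk U) (funext fun i => (h i).apply_symm_apply _)
  map_fun' := (ultraEmb U fun i => (h i).toEmbedding).map_fun'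
  map_rel' := (ultraEmb U fun i => (h i).toEmbedding).map_rel'

/-- The diagonal embedding into an ultrapower. -/
def ultraDiag (L : FirstOrder.Language.{u, u}) (U : Ultrafilter I) (M : Type u) [L.Structure M] :
    M ↪[L] (U : Filter I).Product fun _ => M where
  toFun m := ultraMk U fun _ => m
  inj' _ _ h := (ultraMk_eq_iff.1 h).exists.choose_spec
  map_fun' φ x := (funMap_ultraMk φ fun k (_ : I) => x k).symm
  map_rel' R x := (relMap_ultraMk R fun k (_ : I) => x k).trans eventually_const

/-- The ultraproduct of substructures, as a substructure of the ultraproduct. -/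
def ultraSub (U : Ultrafilter I) (S : ∀ i, L.Substructure (N i)) :
    L.Substructure ((U : Filter I).Product N) :=
  (ultraEmb U fun i => (S i).subtype).toHom.range

theorem mem_ultraSub_iff_exists {S : ∀ i, L.Substructure (N i)} {x : (U : Filter I).Product N} :
    x ∈ ultraSub U S ↔ ∃ f : ∀ i, N i, (∀ i, f i ∈ S i) ∧ ultraMk U f = x := by
  constructor
  · rintro ⟨y, rfl⟩
    obtain ⟨f, rfl⟩ := ultraMk_surjective y
    exact ⟨fun i => f i, fun i => (f i).2, rfl⟩
  · rintro ⟨f, hf, rfl⟩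
    exact ⟨ultraMk U fun i => ⟨f i, hf i⟩, rfl⟩

theorem ultraMk_mem_ultraSub {S : ∀ i, L.Substructure (N i)} [∀ i, Nonempty (S i)]
    {f : ∀ i, N i} : ultraMk U f ∈ ultraSub U S ↔ ∀ᶠ i in (U : Filter I), f i ∈ S i := by
  classical
  rw [mem_ultraSub_iff_exists]
  constructor
  · rintro ⟨g, hg, hgf⟩
    exact (ultraMk_eq_iff.1 hgf).mono fun i hi => hi ▸ hg i
  · intro h
    -- Values off the large set do not affect the class, so they may be moved into `S i`; this needs
    -- `S i` nonempty.
    refine ⟨fun i => if f i ∈ S i then f i else (Classical.arbitrary (S i) : S i), fun i => ?_,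
      ultraMk_eq_iff.2 (h.mono fun i hi => if_pos hi)⟩
    dsimp only
    split_ifs with hi
    exacts [hi, Subtype.prop _]

theorem ultraSub_mono {S T : ∀ i, L.Substructure (N i)} (h : ∀ i, S i ≤ T i) :
    ultraSub U S ≤ ultraSub U T := fun x hx => by
  obtain ⟨f, hf, rfl⟩ := mem_ultraSub_iff_exists.1 hx
  exact mem_ultraSub_iff_exists.2 ⟨f, fun i => h i (hf i), rfl⟩

theorem ultraSub_top : ultraSub U (fun i => (⊤ : L.Substructure (N i))) = ⊤ := by
  ext x
  obtain ⟨f, rfl⟩ := ultraMk_surjective x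
  simpa using mem_ultraSub_iff_exists.2 ⟨f, fun i => Language.Substructure.mem_top _, rfl⟩

theorem range_ultraEmb (g : ∀ i, M i ↪[L] N i) :
    (ultraEmb U g).toHom.range = ultraSub U fun i => (g i).toHom.range := by
  ext x
  rw [mem_ultraSub_iff_exists]
  constructor
  · rintro ⟨y, rfl⟩
    obtain ⟨f, rfl⟩ := ultraMk_surjective y
    exact ⟨fun i => g i (f i), fun i => ⟨f i, rfl⟩, rfl⟩
  · rintro ⟨f, hf, rfl⟩
    choose f' hf' using hf
    exact ⟨ultraMk U f', congrArg (ultraMk U) (funext hf')⟩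

/-! ### Ultraproducts of small structures -/

/-- Otherwise the fibres of `f` would be fewer than κ null sets covering `I`. -/
theorem exists_eventually_eq_of_card_lt {κ : Cardinal.{u}} [CardinalInterFilter (U : Filter I) κ]
    {A : Type u} (hA : #A < κ) (f : I → A) : ∃ a, ∀ᶠ i in (U : Filter I), f i = a := by
  by_contra h
  rw [not_exists] at h
  have : ∀ᶠ i in (U : Filter I), ∀ a, f i ≠ a :=
    (eventually_cardinal_forall hA).2 fun a => Ultrafilter.eventually_not.2 (h a)
  obtain ⟨i, hi⟩ := this.exists
  exact hi _ rfl

theorem card_functions_le (n : ℕ) : #(L.Functions n) ≤ L.card :=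
  Cardinal.mk_le_of_injective (f := fun f => (Sum.inl ⟨n, f⟩ : L.Symbols))
    fun f g h => by simpa using h

theorem card_relations_le (n : ℕ) : #(L.Relations n) ≤ L.card :=
  Cardinal.mk_le_of_injective (f := fun f => (Sum.inr ⟨n, f⟩ : L.Symbols))
    fun f g h => by simpa using h

/-- All factors are enumerated by one set `J` of size `c`, and every element of the ultraproduct is
the class `E a` of a constant index `a`. The atomic diagram of `E` involves at most `c < κ`
conditions, so some single factor realizes exactly the same ones. -/
theorem exists_equiv_ultraproduct_of_card_le {κ c : Cardinal.{u}}
    [CardinalInterFilter (U : Filter I) κ] (hcκ : c < κ) (hc : ℵ₀ ≤ c) (hL : L.card ≤ c)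
    (hM : ∀ i, #(M i) ≤ c) (S : ∀ i, L.Substructure (M i)) [∀ i, Nonempty (S i)] :
    ∃ i, ∃ e : (U : Filter I).Product M ≃[L] M i, ∀ x, x ∈ ultraSub U S ↔ e x ∈ S i := by
  classical
  have hne : ∀ i, Nonempty (M i) := fun i => (inferInstance : Nonempty (S i)).map (↑)
  let J := c.out
  have hJ : #J = c := Cardinal.mk_out c
  have hs : ∀ i, ∃ s : J → M i, Function.Surjective s := fun i => by
    have : #(M i) ≤ #J := (hM i).trans_eq hJ.symm
    obtain ⟨g⟩ := this
    exact ⟨_, Function.invFun_surjective g.injective⟩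
  choose s hs using hs
  let E : J → (U : Filter I).Product M := fun a => ultraMk U fun i => s i a
  have hE : Function.Surjective E := fun x => by
    obtain ⟨f, rfl⟩ := ultraMk_surjective x
    choose g hg using fun i => hs i (f i)
    obtain ⟨a, ha⟩ := exists_eventually_eq_of_card_lt (U := U) (hJ.trans_lt hcκ) g
    exact ⟨a, ultraMk_eq_iff.2 (ha.mono fun i hi => by rw [← hg, hi])⟩
  choose d hd using hE
  -- The ultrafilter decides `p`, so its truth value on a large set agrees with the fixed truth
  -- value of `q`.
  have hU : ∀ {p : I → Prop} {q : Prop}, (q ↔ ∀ᶠ i in (U : Filter I), p i) →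
      ∀ᶠ i in (U : Filter I), (q ↔ p i) := fun {p q} h => by
    by_cases hq : q
    · exact (h.1 hq).mono fun i hi => iff_of_true hq hi
    · exact (Ultrafilter.eventually_not.2 (mt h.2 hq)).mono fun i hi => iff_of_false hq hi
  have hpow : ∀ n : ℕ, #(Fin n → J) < κ := fun n => by
    refine lt_of_le_of_lt ?_ hcκ
    simpa [hJ] using Cardinal.power_nat_le (n := n) hc
  have hnat : #(ULift.{u} ℕ) < κ := by simpa using hc.trans_lt hcκ
  have h₁ : ∀ᶠ i in (U : Filter I), ∀ a b, E a = E b ↔ s i a = s i b :=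
    (eventually_cardinal_forall (hJ.trans_lt hcκ)).2 fun a =>
      (eventually_cardinal_forall (hJ.trans_lt hcκ)).2 fun b => hU ultraMk_eq_iff
  have h₂ : ∀ᶠ i in (U : Filter I), ∀ n : ULift.{u} ℕ, ∀ φ : L.Functions n.down,
      ∀ a : Fin n.down → J, ∀ b, (Language.Structure.funMap φ fun k => E (a k)) = E b ↔
        (Language.Structure.funMap φ fun k => s i (a k)) = s i b :=
    (eventually_cardinal_forall hnat).2 fun n =>
      (eventually_cardinal_forall (((card_functions_le _).trans hL).trans_lt hcκ)).2 fun φ =>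
      (eventually_cardinal_forall (hpow _)).2 fun a =>
      (eventually_cardinal_forall (hJ.trans_lt hcκ)).2 fun b => hU (by
        rw [funMap_ultraMk]
        exact ultraMk_eq_iff)
  have h₃ : ∀ᶠ i in (U : Filter I), ∀ n : ULift.{u} ℕ, ∀ R : L.Relations n.down,
      ∀ a : Fin n.down → J, (Language.Structure.RelMap R fun k => E (a k)) ↔
        (Language.Structure.RelMap R fun k => s i (a k)) :=
    (eventually_cardinal_forall hnat).2 fun n =>
      (eventually_cardinal_forall (((card_relations_le _).trans hL).trans_lt hcκ)).2 fun R =>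
      (eventually_cardinal_forall (hpow _)).2 fun a => hU (relMap_ultraMk R _)
  have h₄ : ∀ᶠ i in (U : Filter I), ∀ a, E a ∈ ultraSub U S ↔ s i a ∈ S i :=
    (eventually_cardinal_forall (hJ.trans_lt hcκ)).2 fun a => hU ultraMk_mem_ultraSub
  obtain ⟨i, h₁, h₂, h₃, h₄⟩ := (h₁.and (h₂.and (h₃.and h₄))).exists
  have hbij : Function.Bijective fun x => s i (d x) := by
    constructor
    · intro x y hxy
      rw [← hd x, ← hd y, h₁]
      exact hxy
    · intro m
      obtain ⟨a, rfl⟩ := hs i m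
      exact ⟨E a, (h₁ _ _).1 (hd _)⟩
  let e : (U : Filter I).Product M ≃[L] M i :=
    { Equiv.ofBijective _ hbij with
      map_fun' := fun {n} φ x => by
        have := (h₂ ⟨n⟩ φ (fun k => d (x k)) (d (Language.Structure.funMap φ x))).1
          (by simp only [hd])
        exact this.symm
      map_rel' := fun {n} R x => by
        have := h₃ ⟨n⟩ R fun k => d (x k)
        simp only [hd] at this
        exact this.symm }
  refine ⟨i, e, fun x => ?_⟩
  have := h₄ (d x)
  rwa [hd] at this

end Ultraproduct

namespace AEC

open Filter

variable {L : FirstOrder.Language.{u, u}} {K : AEC L} {I : Type u} {U : Ultrafilter I}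

/-! ### Classes with a small Löwenheim-Skolem number -/

section LS

theorem LS_spec (K : AEC L) : L.card + ℵ₀ ≤ K.LS ∧
    ∀ (M : Type u) [L.Structure M], K.Mem M → ∀ A : Set M,
      ∃ S : L.Substructure M, K.Strong S ∧ A ⊆ S ∧ #S ≤ #A + K.LS :=
  csInf_mem (s := {c : Cardinal.{u} | L.card + ℵ₀ ≤ c ∧
    ∀ (M : Type u) [L.Structure M], K.Mem M → ∀ A : Set M,
      ∃ S : L.Substructure M, K.Strong S ∧ A ⊆ S ∧ #S ≤ #A + c}) K.exists_LS

theorem aleph0_le_LS (K : AEC L) : ℵ₀ ≤ K.LS := le_add_self.trans K.LS_spec.1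

theorem exists_prec_card_le {M : Type u} [L.Structure M] {X : L.Substructure M} (hX : K.Mem X)
    {A : Set M} (hA : A ⊆ X) (hc : #A ≤ K.LS) :
    ∃ S, K.Prec S X ∧ A ⊆ S ∧ #S ≤ K.LS := by
  obtain ⟨S, hS, hAS, hc'⟩ := K.LS_spec.2 X hX (X.subtype ⁻¹' A)
  refine ⟨S.map X.subtype.toHom, ?_, fun a ha => ⟨⟨a, hA ha⟩, hAS ha, rfl⟩, ?_⟩
  · have := (K.prec_range_iff X.subtype).2 hS
    rwa [Language.Substructure.range_subtype] at this
  · refine (Cardinal.mk_image_le (s := (S : Set X)) (f := X.subtype)).trans (hc'.trans ?_)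
    refine (add_le_add_left ((Cardinal.mk_preimage_of_injective _ _
      X.subtype.injective).trans hc) _).trans ?_
    exact (Cardinal.add_eq_self K.aleph0_le_LS).le

theorem exists_prec_of_prec_of_prec {M : Type u} [L.Structure M] {S T X : L.Substructure M}
    (hS : K.Prec S X) (hT : K.Prec T X) (hSc : #S ≤ K.LS) (hTc : #T ≤ K.LS) :
    ∃ R, K.Prec S R ∧ K.Prec T R ∧ K.Prec R X ∧ #R ≤ K.LS := by
  obtain ⟨R, hR, hle, hc⟩ := exists_prec_card_le hS.mem_right
    (Set.union_subset (s := (S : Set M)) (t := T) hS.1 hT.1)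
    ((Cardinal.mk_union_le _ _).trans
      ((add_le_add hSc hTc).trans (Cardinal.add_eq_self K.aleph0_le_LS).le))
  exact ⟨R, hS.of_le hR (Set.subset_union_left.trans hle),
    hT.of_le hR (Set.subset_union_right.trans hle), hR, hc⟩

theorem exists_mem_prec_card_le {M : Type u} [L.Structure M] {X : L.Substructure M}
    (hX : K.Mem X) {m : M} (hm : m ∈ X) : ∃ S, K.Prec S X ∧ m ∈ S ∧ #S ≤ K.LS := by
  obtain ⟨S, h₁, h₂, h₃⟩ := exists_prec_card_le hX (A := {m}) (by simpa using hm)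
    (by simpa using one_le_aleph0.trans K.aleph0_le_LS)
  exact ⟨S, h₁, h₂ rfl, h₃⟩

variable {κ : Cardinal.{u}} [CardinalInterFilter (U : Filter I) κ] {N : I → Type u}
  [∀ i, L.Structure (N i)]

/-- The pair of ultraproducts is isomorphic to one of the pairs `(T i, S i)`. -/
theorem prec_ultraSub_of_card_le (hκ : K.LS < κ) {S T : ∀ i, L.Substructure (N i)}
    (h : ∀ i, K.Prec (S i) (T i)) (hc : ∀ i, #(T i) ≤ K.LS) :
    K.Prec (ultraSub U S) (ultraSub U T) := by
  have hne : ∀ i, Nonempty (S i) := fun i => K.nonempty_of_mem _ (h i).mem_left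
  have hne' : ∀ i, Nonempty ((S i).comap (T i).subtype.toHom) := fun i =>
    K.nonempty_of_mem _ (K.mem_sub_of_strong _ (h i).2)
  refine (K.prec_iff_strong (ultraEmb U fun i => (T i).subtype)
    (S := ultraSub U fun i => (S i).comap (T i).subtype.toHom) rfl
    (ultraSub_mono fun i => (h i).1) fun x => ?_).2 ?_
  · obtain ⟨f, rfl⟩ := ultraMk_surjective x
    rw [ultraEmb_ultraMk, ultraMk_mem_ultraSub, ultraMk_mem_ultraSub]
    rfl
  · obtain ⟨i, e, he⟩ := exists_equiv_ultraproduct_of_card_le (U := U) hκ K.aleph0_le_LS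
      (le_self_add.trans K.LS_spec.1) hc fun i => (S i).comap (T i).subtype.toHom
    exact (K.strong_congr_iff e he).2 (h i).2

/-- Every class has a representative covered by a choice of small `A i ≺_K S i`, and two such
choices have a common small bound coordinatewise. So the ultraproduct of the `S i` is a directed
union. -/
theorem prec_ultraSub_of_forall_card_le (hκ : K.LS < κ) {S : ∀ i, L.Substructure (N i)}
    (hS : ∀ i, K.Mem (S i)) :
    (∀ A : ∀ i, L.Substructure (N i), (∀ i, K.Prec (A i) (S i)) → (∀ i, #(A i) ≤ K.LS) →
      K.Prec (ultraSub U A) (ultraSub U S)) ∧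
    ∀ Y, (∀ A : ∀ i, L.Substructure (N i), (∀ i, K.Prec (A i) (S i)) → (∀ i, #(A i) ≤ K.LS) →
      K.Prec (ultraSub U A) Y) → K.Prec (ultraSub U S) Y := by
  let J := {A : ∀ i, L.Substructure (N i) // ∀ i, K.Prec (A i) (S i) ∧ #(A i) ≤ K.LS}
  have hex : ∀ f : ∀ i, N i, (∀ i, f i ∈ S i) → ∃ A : J, ∀ i, f i ∈ A.1 i := fun f hf => by
    choose A h₁ h₂ h₃ using fun i => exists_mem_prec_card_le (hS i) (hf i)
    exact ⟨⟨A, fun i => ⟨h₁ i, h₃ i⟩⟩, h₂⟩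
  have hne : Nonempty J := by
    have f := fun i => (K.nonempty_of_mem _ (hS i)).some
    exact ⟨(hex (fun i => f i) fun i => (f i).2).choose⟩
  have := prec_of_directed (K := K) (S := fun A : J => ultraSub U A.1) (X := ultraSub U S)
    (fun A => (prec_ultraSub_of_card_le hκ (fun i => .refl (A.2 i).1.mem_left)
      fun i => (A.2 i).2).mem_left) (fun A B => ?_) ?_
  · exact ⟨fun A h₁ h₂ => this.1 ⟨A, fun i => ⟨h₁ i, h₂ i⟩⟩,
      fun Y hY => this.2 Y fun A => hY A.1 (fun i => (A.2 i).1) fun i => (A.2 i).2⟩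
  · choose C h₁ h₂ h₃ h₄ using fun i =>
      exists_prec_of_prec_of_prec (A.2 i).1 (B.2 i).1 (A.2 i).2 (B.2 i).2
    exact ⟨⟨C, fun i => ⟨h₃ i, h₄ i⟩⟩, prec_ultraSub_of_card_le hκ h₁ h₄,
      prec_ultraSub_of_card_le hκ h₂ h₄⟩
  · ext x
    rw [Set.mem_iUnion]
    constructor
    · intro hx
      obtain ⟨f, hf, rfl⟩ := mem_ultraSub_iff_exists.1 hx
      obtain ⟨A, hA⟩ := hex f hf
      exact ⟨A, mem_ultraSub_iff_exists.2 ⟨f, hA, rfl⟩⟩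
    · rintro ⟨A, hA⟩
      exact ultraSub_mono (fun i => (A.2 i).1.1) hA

/-- Small strong substructures of `S i` are also strong in `N i`, so the ultraproduct of the `N i`
bounds the directed system whose union is the ultraproduct of the `S i`. -/
theorem strong_ultraSub_of_LS_lt (hκ : K.LS < κ) {S : ∀ i, L.Substructure (N i)}
    (hS : ∀ i, K.Strong (S i)) : K.Strong (ultraSub U S) := by
  rw [← prec_top_iff, ← ultraSub_top]
  have hS' := fun i => (prec_top_iff K).2 (hS i)
  exact (prec_ultraSub_of_forall_card_le hκ fun i => (hS' i).mem_left).2 _ fun A hA hc =>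
    (prec_ultraSub_of_forall_card_le hκ fun i => (hS' i).mem_right).1 A
      (fun i => (hA i).trans (hS' i)) hc

theorem strong_range_ultraDiag_of_LS_lt (hκ : K.LS < κ) {M : Type u} [L.Structure M]
    (hM : K.Mem M) : K.Strong (ultraDiag L U M).toHom.range := by
  have htop : K.Mem (⊤ : L.Substructure M) :=
    ((prec_top_iff K).2 (K.strong_refl M hM)).mem_left
  let J := {A : L.Substructure M // K.Prec A ⊤ ∧ #A ≤ K.LS}
  have hex : ∀ m : M, ∃ A : J, m ∈ A.1 := fun m => by
    obtain ⟨A, h₁, h₂, h₃⟩ := exists_mem_prec_card_le htop (Language.Substructure.mem_top m)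
    exact ⟨⟨A, h₁, h₃⟩, h₂⟩
  have hne : Nonempty J := by
    obtain ⟨m⟩ := K.nonempty_of_mem _ hM
    exact ⟨(hex m).choose⟩
  rw [← prec_top_iff]
  refine (prec_of_directed (K := K) (S := fun A : J => ultraSub U fun _ => A.1)
    (fun A => (prec_ultraSub_of_card_le hκ (fun i => .refl A.2.1.mem_left)
      fun i => A.2.2).mem_left) (fun A B => ?_) ?_).2 _ fun A => ?_
  · obtain ⟨C, h₁, h₂, h₃, h₄⟩ := exists_prec_of_prec_of_prec A.2.1 B.2.1 A.2.2 B.2.2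
    exact ⟨⟨C, h₃, h₄⟩, prec_ultraSub_of_card_le hκ (fun _ => h₁) fun _ => h₄,
      prec_ultraSub_of_card_le hκ (fun _ => h₂) fun _ => h₄⟩
  · ext x
    rw [Set.mem_iUnion]
    constructor
    · rintro ⟨m, rfl⟩
      obtain ⟨A, hA⟩ := hex m
      exact ⟨A, mem_ultraSub_iff_exists.2 ⟨fun _ => m, fun _ => hA, rfl⟩⟩
    · rintro ⟨A, hA⟩
      obtain ⟨f, hf, rfl⟩ := mem_ultraSub_iff_exists.1 hA
      -- As `A` has fewer than κ elements, `f` is constant on a large set, so its class is diagonal.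
      obtain ⟨a, ha⟩ := exists_eventually_eq_of_card_lt (U := U) (A.2.2.trans_lt hκ)
        fun i => (⟨f i, hf i⟩ : A.1)
      exact ⟨a, ultraMk_eq_iff.2 (ha.mono fun i hi => (congrArg Subtype.val hi).symm)⟩
  · exact (prec_top_iff K).2 (strong_ultraSub_of_LS_lt hκ fun _ => (prec_top_iff K).1 A.2.1)

end LS

end AEC

/-! ### Łoś's theorem for `L_{κ,ω}` -/

namespace InfFormula

open Filter

variable {L : FirstOrder.Language.{u, u}} {κ : Cardinal.{u}}

theorem realize_term_equiv {M N : Type u} [L.Structure M] [L.Structure N] (e : M ≃[L] N) {n : ℕ}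
    (t : L.Term (Fin n)) (v : Fin n → M) : (t.realize fun k => e (v k)) = e (t.realize v) :=
  Language.HomClass.realize_term e

theorem realize_equiv {M N : Type u} [L.Structure M] [L.Structure N] (e : M ≃[L] N) {n : ℕ}
    (φ : InfFormula L κ n) (v : Fin n → M) : φ.Realize (fun k => e (v k)) ↔ φ.Realize v := by
  induction φ with
  | falsum => rfl
  | equal s t =>
    simp only [Realize]
    rw [realize_term_equiv, realize_term_equiv, e.injective.eq_iff]
  | rel R ts =>
    simp only [Realize]
    simp_rw [realize_term_equiv]
    exact e.map_rel R _
  | imp φ ψ ih₁ ih₂ => simp only [Realize, ih₁, ih₂]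
  | all φ ih =>
    simp only [Realize]
    rw [← e.toEquiv.forall_congr_right]
    refine forall_congr' fun a => ?_
    rw [← ih]
    refine iff_of_eq (congrArg _ (funext fun k => ?_))
    refine Fin.lastCases ?_ (fun j => ?_) k
    · simp
      rfl
    · simp
  | conj hι φ ih => simp only [Realize, ih]

variable {I : Type u} {U : Ultrafilter I} [CardinalInterFilter (U : Filter I) κ] {M : I → Type u}
  [∀ i, L.Structure (M i)] [∀ i, Nonempty (M i)]

theorem realize_ultraMk {n : ℕ} (φ : InfFormula L κ n) (v : Fin n → ∀ i, M i) :
    φ.Realize (fun k => ultraMk U (v k)) ↔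
      ∀ᶠ i in (U : Filter I), φ.Realize fun k => v k i := by
  classical
  induction φ with
  | falsum => exact eventually_const.symm
  | equal s t =>
    simp only [Realize]
    rw [realize_term_ultraMk, realize_term_ultraMk]
    exact ultraMk_eq_iff
  | rel R ts =>
    simp only [Realize]
    simp_rw [realize_term_ultraMk]
    exact relMap_ultraMk R _
  | imp φ ψ ih₁ ih₂ =>
    simp only [Realize, ih₁, ih₂]
    exact Ultrafilter.eventually_imp.symm
  | all φ ih =>
    simp only [Realize]
    have hsnoc : ∀ (f : ∀ i, M i), (Fin.snoc (fun k => ultraMk U (v k)) (ultraMk U f) :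
        Fin _ → (U : Filter I).Product M) =
          fun k => ultraMk U ((Fin.snoc v f : Fin _ → ∀ i, M i) k) := fun f => by
      funext k
      refine Fin.lastCases ?_ (fun j => ?_) k <;> simp
    have hsnoc' : ∀ (f : ∀ i, M i) i, (fun k => (Fin.snoc v f : Fin _ → ∀ i, M i) k i) =
        Fin.snoc (fun k => v k i) (f i) := fun f i => by
      funext k
      refine Fin.lastCases ?_ (fun j => ?_) k <;> simp
    rw [ultraMk_surjective.forall]
    simp_rw [hsnoc, ih, hsnoc']
    constructor
    · intro h
      -- A counterexample to the universal statement is picked wherever there is one, so truth at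
      -- the chosen point implies truth everywhere.
      have : ∀ i, ∃ a, φ.Realize (Fin.snoc (fun k => v k i) a) →
          ∀ b, φ.Realize (Fin.snoc (fun k => v k i) b) := fun i => by
        by_cases hi : ∀ b, φ.Realize (Fin.snoc (fun k => v k i) b)
        · exact ⟨Classical.arbitrary _, fun _ => hi⟩
        · obtain ⟨b, hb⟩ := not_forall.1 hi
          exact ⟨b, fun h => absurd h hb⟩
      choose f hf using this
      exact (h f).mono fun i hi => hf i hi
    · exact fun h f => h.mono fun i hi => hi (f i)
  | conj hι φ ih =>
    simp only [Realize, ih]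
    exact (eventually_cardinal_forall hι).symm

end InfFormula

namespace AEC

open Filter

variable {L : FirstOrder.Language.{u, u}} {K : AEC L} {I : Type u} {U : Ultrafilter I}
  {κ : Cardinal.{u}}

/-- Transport along `M ≃ g(M)` allows parameters to be taken in `M`, where Łoś's theorem applies to
representatives. -/
theorem IsModClass.strong_range_iff {T : Set (InfFormula L κ 0)} {F : Fragment L κ}
    (h : K.IsModClass T F) {M N : Type u} [L.Structure M] [L.Structure N] (g : M ↪[L] N) :
    K.Strong g.toHom.range ↔ K.Mem M ∧ K.Mem N ∧ ∀ n, ∀ φ ∈ F.formulas n, ∀ v : Fin n → M,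
      φ.Realize v ↔ φ.Realize fun k => g (v k) := by
  rw [h.2, ← K.mem_iso_iff g.equivRange]
  refine and_congr_right fun _ => and_congr_right fun _ => forall_congr' fun n =>
    forall_congr' fun φ => forall_congr' fun _ => ?_
  rw [← (Equiv.arrowCongr (Equiv.refl (Fin n)) g.equivRange.toEquiv).forall_congr_right]
  refine forall_congr' fun v => iff_congr (φ.realize_equiv g.equivRange v) Iff.rfl

variable [CardinalInterFilter (U : Filter I) κ]

theorem IsModClass.mem_product {T : Set (InfFormula L κ 0)} {F : Fragment L κ}
    (h : K.IsModClass T F) {M : I → Type u} [∀ i, L.Structure (M i)] (hM : ∀ i, K.Mem (M i)) :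
    K.Mem ((U : Filter I).Product M) := by
  have hne : ∀ i, Nonempty (M i) := fun i => K.nonempty_of_mem _ (hM i)
  refine (h.1 _).2 ⟨⟨ultraMk U fun i => Classical.arbitrary _⟩, fun φ hφ => ?_⟩
  rw [Subsingleton.elim (Fin.elim0 : Fin 0 → (U : Filter I).Product M)
    fun k => ultraMk U (Fin.elim0 k), φ.realize_ultraMk]
  refine .of_forall fun i => ?_
  rw [Subsingleton.elim (fun k : Fin 0 => (Fin.elim0 k : ∀ i, M i) i) Fin.elim0]
  exact ((h.1 _).1 (hM i)).2 φ hφ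

theorem IsModClass.strong_ultraSub {T : Set (InfFormula L κ 0)} {F : Fragment L κ}
    (h : K.IsModClass T F) {N : I → Type u} [∀ i, L.Structure (N i)]
    {S : ∀ i, L.Substructure (N i)} (hS : ∀ i, K.Strong (S i)) : K.Strong (ultraSub U S) := by
  have hSm := fun i => K.mem_sub_of_strong _ (hS i)
  have hNm := fun i => K.mem_of_strong _ (hS i)
  have hne : ∀ i, Nonempty (S i) := fun i => K.nonempty_of_mem _ (hSm i)
  have hne' : ∀ i, Nonempty (N i) := fun i => K.nonempty_of_mem _ (hNm i)
  refine (h.strong_range_iff _).2 ⟨h.mem_product hSm, h.mem_product hNm, fun n φ hφ v => ?_⟩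
  choose f hf using fun k => ultraMk_surjective (v k)
  obtain rfl : v = fun k => ultraMk U (f k) := funext fun k => (hf k).symm
  rw [φ.realize_ultraMk]
  refine Iff.trans ?_ (φ.realize_ultraMk fun k i => (f k i : N i)).symm
  exact eventually_congr (.of_forall fun i => ((h.2 _).1 (hS i)).2.2 n φ hφ fun k => f k i)

theorem IsModClass.strong_range_ultraDiag {T : Set (InfFormula L κ 0)} {F : Fragment L κ}
    (h : K.IsModClass T F) {M : Type u} [L.Structure M] (hM : K.Mem M) :
    K.Strong (ultraDiag L U M).toHom.range := by
  have hne : Nonempty M := K.nonempty_of_mem _ hM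
  refine (h.strong_range_iff _).2 ⟨hM, h.mem_product fun _ => hM, fun n φ hφ v => ?_⟩
  exact ((φ.realize_ultraMk fun k (_ : I) => v k).trans eventually_const).symm

/-! ### Ultraproducts in classes essentially below `κ` -/

theorem EssentiallyBelow.strong_ultraSub (hK : K.EssentiallyBelow κ) {N : I → Type u}
    [∀ i, L.Structure (N i)] {S : ∀ i, L.Substructure (N i)} (hS : ∀ i, K.Strong (S i)) :
    K.Strong (ultraSub U S) := by
  obtain h | ⟨T, F, h⟩ := hK
  exacts [strong_ultraSub_of_LS_lt h hS, h.strong_ultraSub hS]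

theorem EssentiallyBelow.mem_product (hK : K.EssentiallyBelow κ) {M : I → Type u}
    [∀ i, L.Structure (M i)] (hM : ∀ i, K.Mem (M i)) : K.Mem ((U : Filter I).Product M) :=
  K.mem_of_strong _ (hK.strong_ultraSub fun i => K.strong_refl _ (hM i))

theorem EssentiallyBelow.isEmbedding_ultraMap (hK : K.EssentiallyBelow κ) {M N : I → Type u}
    [∀ i, L.Structure (M i)] [∀ i, L.Structure (N i)] {h : ∀ i, M i → N i}
    (hh : ∀ i, K.IsEmbedding (h i)) : K.IsEmbedding (ultraMap U h) := by
  choose g hg hgS using hh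
  obtain rfl : (fun i => ⇑(g i)) = h := funext hg
  refine ⟨ultraEmb U g, rfl, ?_⟩
  rw [range_ultraEmb]
  exact hK.strong_ultraSub hgS

theorem EssentiallyBelow.isEmbedding_ultraDiag (hK : K.EssentiallyBelow κ) {M : Type u}
    [L.Structure M] (hM : K.Mem M) : K.IsEmbedding (ultraDiag L U M) := by
  refine ⟨_, rfl, ?_⟩
  obtain h | ⟨T, F, h⟩ := hK
  exacts [strong_range_ultraDiag_of_LS_lt h hM, h.strong_range_ultraDiag hM]

theorem isEmbedding_subtype {N : Type u} [L.Structure N] {S : L.Substructure N}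
    (hS : K.Strong S) : K.IsEmbedding ((↑) : S → N) :=
  ⟨S.subtype, rfl, by rwa [Language.Substructure.range_subtype]⟩

theorem EssentiallyBelow.canonicalMapIsEmbedding (hK : K.EssentiallyBelow κ) {M : Type u}
    [L.Structure M] {S : I → L.Substructure M} (hmem : ∀ i, K.Mem (S i))
    (hd : ∀ i j, ∃ k, K.Prec (S i) (S k) ∧ K.Prec (S j) (S k))
    (hS : (⋃ i, (S i : Set M)) = Set.univ) (hU : ∀ m : M, {i | m ∈ S i} ∈ U) :
    CanonicalMapIsEmbedding K U S := by
  classical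
  have hI : Nonempty I := Filter.nonempty_of_neBot (U : Filter I)
  have hprec := (prec_of_directed hmem hd (X := ⊤) (by simp [hS])).1
  have hM : K.Mem M :=
    (K.mem_iso_iff Language.Substructure.topEquiv).1 (hprec hI.some).mem_right
  have hne : ∀ i, Nonempty (S i) := fun i => K.nonempty_of_mem _ (hmem i)
  refine ⟨hM, ⟨fun m i => if h : m ∈ S i then ⟨m, h⟩ else Classical.arbitrary _,
    fun m i h => by simp [h]⟩, fun f hf => ?_⟩
  refine (hK.isEmbedding_ultraMap (U := U) fun i =>
    isEmbedding_subtype ((prec_top_iff K).1 (hprec i))).of_comp ?_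
  -- The composite is the diagonal map, because `f m i = m` for almost all `i`.
  convert hK.isEmbedding_ultraDiag (U := U) hM using 1
  funext m
  exact ultraMk_eq_iff.2 (Filter.mem_of_superset (hU m) fun i hi => hf m i hi)

/-- By non-principality all complements of points are large, and `s` is an intersection of fewer
than κ of them. -/
theorem mem_of_card_compl_lt (hU : ∀ i, U ≠ pure i) {s : Set I} (hs : #(sᶜ : Set I) < κ) :
    s ∈ U := by
  have : (⋂ i ∈ sᶜ, ({i}ᶜ : Set I)) ∈ (U : Filter I) := by
    refine (Filter.cardinal_bInter_mem hs).2 fun i _ => ?_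
    refine Ultrafilter.compl_mem_iff_notMem.2 fun h => hU i ?_
    obtain ⟨x, hx, hUx⟩ := Ultrafilter.eq_pure_of_finite_mem (Set.finite_singleton i) h
    rw [hUx, Set.mem_singleton_iff.1 hx]
  refine Filter.mem_of_superset this fun x hx => ?_
  by_contra hxs
  simpa using Set.mem_iInter₂.1 hx x hxs

theorem setOf_ge_mem [LinearOrder I] [WellFoundedLT I]
    (hI : Ordinal.type (fun i j : I => i < j) = κ.ord) (hU : ∀ i, U ≠ pure i) (i : I) :
    {j | i ≤ j} ∈ U := by
  refine mem_of_card_compl_lt (κ := κ) hU ?_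
  have hκ : #I = κ := by rw [← Ordinal.card_type (fun i j : I => i < j), hI, Cardinal.card_ord]
  -- The index order has the type of an initial ordinal, so its proper initial segments have size
  -- less than κ.
  have := Cardinal.mk_Iio_lt i (by rw [hκ, hI])
  rw [hκ] at this
  convert this using 3
  ext j
  simp

end AEC

end LosAEC

theorem mainTheorem4 {L : FirstOrder.Language.{u, u}} (K : LosAEC.AEC L) (κ : Cardinal.{u})
    (hK : K.EssentiallyBelow κ) {I : Type u} (U : Ultrafilter I)
    (hU : CardinalInterFilter (U : Filter I) κ) :
    -- (1) closure under ultraproducts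
    (∀ (M : I → Type u) [∀ i, L.Structure (M i)], (∀ i, K.Mem (M i)) →
      K.Mem ((U : Filter I).Product M)) ∧
    -- (2) strong substructures
    (∀ (N : I → Type u) [∀ i, L.Structure (N i)] (S : ∀ i, L.Substructure (N i)),
      (∀ i, K.Strong (S i)) →
      K.IsEmbedding (LosAEC.ultraMap U fun i => ((↑) : S i → N i))) ∧
    -- (3) isomorphisms
    (∀ (M N : I → Type u) [∀ i, L.Structure (M i)] [∀ i, L.Structure (N i)],
      (∀ i, K.Mem (M i)) → (∀ i, K.Mem (N i)) → ∀ h : ∀ i, M i ≃[L] N i,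
      ∃ e : (U : Filter I).Product M ≃[L] (U : Filter I).Product N,
        ⇑e = LosAEC.ultraMap U fun i => ⇑(h i)) ∧
    -- (4) `K`-embeddings
    (∀ (M N : I → Type u) [∀ i, L.Structure (M i)] [∀ i, L.Structure (N i)]
      (h : ∀ i, M i → N i), (∀ i, K.IsEmbedding (h i)) →
      K.IsEmbedding (LosAEC.ultraMap U h)) ∧
    -- the diagonal embedding into an ultrapower
    (∀ (M : Type u) [L.Structure M], K.Mem M →
      K.IsEmbedding (fun m : M => ((fun _ => m : I → M) : (U : Filter I).Product fun _ => M))) ∧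
    -- (5) increasing chains of length `κ` (not necessarily continuous)
    (∀ [LinearOrder I] [WellFoundedLT I], Ordinal.type (fun i j : I => i < j) = κ.ord →
      (∀ i, U ≠ pure i) →
      ∀ (M : Type u) [L.Structure M] (S : I → L.Substructure M), (∀ i, K.Mem (S i)) →
      (∀ i j, i < j → K.Prec (S i) (S j)) → (⋃ i, (S i : Set M)) = Set.univ →
      LosAEC.CanonicalMapIsEmbedding K U S) ∧
    -- (6) directed systems and fine ultrafilters
    (∀ (M : Type u) [L.Structure M] (S : I → L.Substructure M), (∀ i, K.Mem (S i)) →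
      (∀ i j, ∃ k, K.Prec (S i) (S k) ∧ K.Prec (S j) (S k)) →
      (⋃ i, (S i : Set M)) = Set.univ → (∀ m : M, {i | m ∈ S i} ∈ U) →
      LosAEC.CanonicalMapIsEmbedding K U S) := by
  refine ⟨fun M _ hM => hK.mem_product hM, fun N _ S hS => ?_, fun M N _ _ _ _ h => ?_,
    fun M N _ _ h hh => hK.isEmbedding_ultraMap hh, fun M _ hM => hK.isEmbedding_ultraDiag hM,
    fun hI hnp M _ S hmem hS hM => ?_, fun M _ S hmem hd hM hm => ?_⟩
  · exact hK.isEmbedding_ultraMap fun i => LosAEC.AEC.isEmbedding_subtype (hS i)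
  · exact ⟨LosAEC.ultraEquiv U h, rfl⟩
  · have hle : ∀ i j, i ≤ j → K.Prec (S i) (S j) := fun i j hij => by
      rcases hij.eq_or_lt with rfl | hlt
      exacts [.refl (hmem i), hS i j hlt]
    refine hK.canonicalMapIsEmbedding hmem
      (fun i j => ⟨max i j, hle _ _ (le_max_left _ _), hle _ _ (le_max_right _ _)⟩) hM fun m => ?_
    obtain ⟨i, hi⟩ := Set.mem_iUnion.1 (hM ▸ Set.mem_univ m)
    exact Filter.mem_of_superset (LosAEC.AEC.setOf_ge_mem hI hnp i) fun j hij => (hle i j hij).1 hi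
  · exact hK.canonicalMapIsEmbedding hmem hd hM hm
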